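/- Let $n\ge 0$ be an integer and let $Z=(z_{ij})$ be a symmetric $n\times n$ matrix of variables, so that $z_{ij}=z_{ji}$; write $\mathbb{C}[Z]$ for the polynomial ring $\mathbb{C}[z_{ij} : 1\le i\le j\le n]$. The $z_{ii}$ are the diagonal variables and the $z_{ij}$ with $i\neq j$ the off-diagonal variables; a diagonal monomial is a monomial (possibly $1$) in which no off-diagonal variable occurs. A polynomial $f\in\mathbb{C}[Z]$ is psd-stable if $f(M)\neq 0$ for every complex symmetric $n\times n$ matrix $M$ whose entrywise imaginary part $\operatorname{Im}(M)$ is positive definite. A binomial is a polynomial in which exactly two monomials occur with non-zero coefficient. For exponents $\alpha,\beta$ of diagonal monomials let $|\alpha-\beta|=\sum_i|\alpha_{ii}-\beta_{ii}|$, and let $e_i$ be the exponent of $z_{ii}$. Let $f\in\mathbb{C}[Z]$ be a psd-stable binomial. Then there are $c_1,c_2\in\mathbb{C}\setminus\{0\}$ and a diagonal monomial $Z^\gamma$ such that one of the following holds. (a) Only diagonal variables appear in $f$, and $f(Z)=Z^\gamma\,(c_1Z^{\alpha_1}+c_2Z^{\alpha_2})$ with diagonal monomials $Z^{\alpha_1},Z^{\alpha_2}$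 that have no common factor, where $|\alpha_1-\alpha_2|\le 2$ and at least one of $\alpha_1,\alpha_2$ is non-zero. Moreover, one of the following is true: (i) $\{\alpha_1,\alpha_2\}=\{0,e_i\}$ for some $i$; (ii) $\{\alpha_1,\alpha_2\}=\{e_i,e_j\}$ for some $i\ne j$, and $c_1/c_2\in\mathbb{R}_{\ge 0}$; (iii) $\{\alpha_1,\alpha_2\}=\{0,e_i+e_j\}$ for some $i,j$ (possibly equal), and $c_1/c_2\in\mathbb{R}_{<0}$. (b) $f(Z)=Z^\gamma\,(c_1z_{ii}z_{jj}+c_2z_{ij}^2)$ for some $i<j$, and $c_1/c_2\in\mathbb{R}$. In particular, at most one off-diagonal variable occurs in $f$, and if one occurs, then the degree of $f$ in it is exactly $2$. -/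

import Mathlib

open MvPolynomial

/-- The variables `z_ij`, `1 ≤ i ≤ j ≤ n`, of a symmetric `n × n` matrix `Z`
(`z_ij` and `z_ji` being identified). -/
abbrev SymVar (n : ℕ) : Type := {p : Fin n × Fin n // p.1 ≤ p.2}

/-- The ring `ℂ[Z]` of polynomials on symmetric `n × n` matrices. -/
abbrev SymPoly (n : ℕ) : Type := MvPolynomial (SymVar n) ℂ

/-- The diagonal variable `z_ii`. -/
def diagVar {n : ℕ} (i : Fin n) : SymVar n := ⟨(i, i), le_rfl⟩

/-- The off-diagonal variable `z_ij`, `i < j`. -/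
def offDiagVar {n : ℕ} (i j : Fin n) (h : i < j) : SymVar n := ⟨(i, j), h.le⟩

/-- A variable `z_ij` is a diagonal variable if `i = j`, otherwise it is off-diagonal. -/
def SymVar.IsDiag {n : ℕ} (v : SymVar n) : Prop := v.1.1 = v.1.2

/-- The value `f(M)` of `f ∈ ℂ[Z]` at a (symmetric) matrix `M`. -/
noncomputable def evalMatrix {n : ℕ} (f : SymPoly n) (M : Matrix (Fin n) (Fin n) ℂ) : ℂ :=
  eval (fun v : SymVar n => M v.1.1 v.1.2) f

/-- `f` is psd-stable: it has no complex symmetric root whose imaginary part is positive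
definite. -/
def PsdStable {n : ℕ} (f : SymPoly n) : Prop :=
  ∀ M : Matrix (Fin n) (Fin n) ℂ, M.IsSymm → (M.map Complex.im).PosDef → evalMatrix f M ≠ 0

/-- A binomial: exactly two monomials occur with non-zero coefficient. -/
def IsBinomial {n : ℕ} (f : SymPoly n) : Prop := f.support.card = 2

/-- The monomial `Z^α` is diagonal: no off-diagonal variable occurs in it. Constants count as
diagonal. -/
def IsDiagExponent {n : ℕ} (α : SymVar n →₀ ℕ) : Prop := ∀ v ∈ α.support, v.IsDiag

/-- The distance `|α - β|`, the sum of the absolute values of the entries of `α - β`. -/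
def expDist {n : ℕ} (α β : SymVar n →₀ ℕ) : ℤ := ∑ v, |(α v : ℤ) - (β v : ℤ)|

/-- The conditions satisfied by a stable binomial `a Z^α + b Z^β` without common factor, in the
variables `z_11, …, z_nn`; `e_i` is the exponent of `z_ii`. -/
def StableBinomialConditions {n : ℕ} (α β : SymVar n →₀ ℕ) (a b : ℂ) : Prop :=
  (∃ i : Fin n, ({α, β} : Set (SymVar n →₀ ℕ)) = {0, Finsupp.single (diagVar i) 1}) ∨
  (∃ i j : Fin n, i ≠ j ∧
    ({α, β} : Set (SymVar n →₀ ℕ)) =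
      {Finsupp.single (diagVar i) 1, Finsupp.single (diagVar j) 1} ∧
    ∃ r : ℝ, 0 ≤ r ∧ a / b = (r : ℂ)) ∨
  (∃ i j : Fin n,
    ({α, β} : Set (SymVar n →₀ ℕ)) =
      {0, Finsupp.single (diagVar i) 1 + Finsupp.single (diagVar j) 1} ∧
    ∃ r : ℝ, r < 0 ∧ a / b = (r : ℂ))

/-- `f = Z^γ (c₁ Z^α₁ + c₂ Z^α₂)` in diagonal variables only, where `Z^α₁` and `Z^α₂` have no
common factor, `|α₁ - α₂| ≤ 2`, one of `α₁, α₂` is non-zero, and the bracket satisfies the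
conditions on stable binomials. -/
def IsDiagonalForm {n : ℕ} (f : SymPoly n) : Prop :=
  (∀ v ∈ f.vars, v.IsDiag) ∧
  ∃ (γ α₁ α₂ : SymVar n →₀ ℕ) (c₁ c₂ : ℂ),
    IsDiagExponent γ ∧ IsDiagExponent α₁ ∧ IsDiagExponent α₂ ∧ c₁ ≠ 0 ∧ c₂ ≠ 0 ∧
    f = monomial γ 1 * (monomial α₁ c₁ + monomial α₂ c₂) ∧
    Disjoint α₁.support α₂.support ∧ expDist α₁ α₂ ≤ 2 ∧ (α₁ ≠ 0 ∨ α₂ ≠ 0) ∧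
    StableBinomialConditions α₁ α₂ c₁ c₂

/-- `f = Z^γ (c₁ z_ii z_jj + c₂ z_ij²)` with `i < j`, `c₁, c₂ ≠ 0`, `c₁ / c₂` real, and `Z^γ` a
diagonal monomial. -/
def IsOffDiagonalForm {n : ℕ} (f : SymPoly n) : Prop :=
  ∃ (γ : SymVar n →₀ ℕ) (i j : Fin n) (h : i < j) (c₁ c₂ : ℂ),
    IsDiagExponent γ ∧ c₁ ≠ 0 ∧ c₂ ≠ 0 ∧ (∃ r : ℝ, c₁ / c₂ = (r : ℂ)) ∧
    f = monomial γ 1 *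
      (C c₁ * X (diagVar i) * X (diagVar j) + C c₂ * X (offDiagVar i j h) ^ 2)

/-! Dividing by the gcd of the two monomials leaves a coprime binomial. Both factors stay
psd-stable, and diagonal test matrices show that the gcd and at least one remaining monomial are
diagonal.

If both are diagonal, put `u` into the variables of one monomial and `-u⁻¹` into those of the other.
A zero is then an `N`-th root in the upper half-plane, `N` being the total degree. Such a root
exists unless `N ≤ 2`, and for `N = 2` it is missing only for positive reals
(`sum_add_sum_le_two_of_stable`).

If an off-diagonal `w` occurs at `(k, l)`, set the other off-diagonal entries to `1`; the constraint
is `(Im w)² < Im z_k · Im z_l`. Were `z_k` or `z_l` absent, enlarging it would free `w` and yield a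
zero, so both occur. The degree bound at `w = 1` then excludes further diagonal variables, and
scaling leaves only `z_k z_l` against `w²` (`exponents_of_stable_offDiag`). -/

/-- Every `N`-th root problem with `N ≥ 3` can be solved in the open upper half-plane, and so can
the square root problem for numbers that are not positive reals. -/
lemma exists_pow_eq_of_im_pos {N : ℕ} {a : ℂ} (ha : a ≠ 0)
    (hN : 3 ≤ N ∨ (N = 2 ∧ ¬ ∃ r : ℝ, 0 < r ∧ a = r)) : ∃ u : ℂ, 0 < u.im ∧ u ^ N = a := by
  have hN2 : 2 ≤ N := by omega
  have hNR : (2 : ℝ) ≤ N := by exact_mod_cast hN2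
  have hN0 : (N : ℂ) ≠ 0 := by
    have : N ≠ 0 := by omega
    exact_mod_cast this
  have hpi := Real.pi_pos
  have him (x : ℂ) : (x / N).im = x.im / N := by
    rw [← Complex.ofReal_natCast, Complex.div_ofReal_im]
  -- The root takes its argument from `arg a` if positive, otherwise from `arg a + 2π`; divided by
  -- `N` this lies in `(0, π)`.
  by_cases harg : 0 < a.arg
  · refine ⟨Complex.exp (Complex.log a / N), ?_, ?_⟩
    · rw [Complex.exp_im, him, Complex.log_im]
      refine mul_pos (Real.exp_pos _) (Real.sin_pos_of_pos_of_lt_pi (by positivity) ?_)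
      rw [div_lt_iff₀ (by positivity)]
      nlinarith [Complex.arg_le_pi a]
    · rw [← Complex.exp_nat_mul, mul_div_cancel₀ _ hN0, Complex.exp_log ha]
  · push Not at harg
    have hlt : a.arg + 2 * Real.pi < N * Real.pi := by
      rcases hN with h | ⟨rfl, h⟩
      · have : (3 : ℝ) ≤ N := by exact_mod_cast h
        nlinarith
      · rcases harg.lt_or_eq with h' | h'
        · push_cast; linarith
        · refine absurd ⟨‖a‖, norm_pos_iff.2 ha, ?_⟩ h
          conv_lhs => rw [← Complex.norm_mul_exp_arg_mul_I a, h']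
          simp
    refine ⟨Complex.exp ((Complex.log a + 2 * Real.pi * Complex.I) / N), ?_, ?_⟩
    · have : (Complex.log a + 2 * Real.pi * Complex.I).im = a.arg + 2 * Real.pi := by
        simp [Complex.log_im]
      rw [Complex.exp_im, him, this]
      refine mul_pos (Real.exp_pos _) (Real.sin_pos_of_pos_of_lt_pi ?_ ?_)
      · have := Complex.neg_pi_lt_arg a
        apply div_pos <;> linarith
      · rw [div_lt_iff₀ (by positivity)]
        linarith
    · rw [← Complex.exp_nat_mul, mul_div_cancel₀ _ hN0, Complex.exp_add, Complex.exp_log ha,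
        Complex.exp_two_pi_mul_I, mul_one]

/-- A binomial without common factor that has no zero with all coordinates in the upper half-plane
has total degree distance at most two, with a sign condition in case of equality. -/
lemma sum_add_sum_le_two_of_stable {ι : Type*} [Fintype ι] {P Q : ι → ℕ}
    (hPQ : ∀ i, P i = 0 ∨ Q i = 0) {c₁ c₂ : ℂ} (h₁ : c₁ ≠ 0) (h₂ : c₂ ≠ 0)
    (H : ∀ z : ι → ℂ, (∀ i, 0 < (z i).im) → c₁ * ∏ i, z i ^ P i + c₂ * ∏ i, z i ^ Q i ≠ 0) :
    ∑ i, P i + ∑ i, Q i ≤ 2 ∧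
      (∑ i, P i + ∑ i, Q i = 2 → ∃ r : ℝ, 0 < r ∧ -(-1) ^ (∑ i, Q i) * c₂ / c₁ = r) := by
  classical
  have ha : -(-1) ^ (∑ i, Q i) * c₂ / c₁ ≠ 0 := by
    simp [h₁, h₂]
  have key : ∀ u : ℂ, 0 < u.im → u ^ (∑ i, P i + ∑ i, Q i) ≠ -(-1) ^ (∑ i, Q i) * c₂ / c₁ := by
    intro u hu huN
    have hu0 : u ≠ 0 := by rintro rfl; simp at hu
    -- Both `u` and `-u⁻¹` lie in the upper half-plane, and disjointness of the supports turns each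
    -- product into a single power.
    apply H (fun i => if Q i = 0 then u else -u⁻¹)
    · intro i
      split_ifs
      · exact hu
      · rw [Complex.neg_im, Complex.inv_im, neg_div, neg_neg]
        exact div_pos hu (Complex.normSq_pos.2 hu0)
    · have e₁ : ∏ i, (if Q i = 0 then u else -u⁻¹) ^ P i = u ^ ∑ i, P i := by
        rw [← Finset.prod_pow_eq_pow_sum]
        refine Finset.prod_congr rfl fun i _ => ?_
        rcases hPQ i with h | h <;> simp [h]
      have e₂ : ∏ i, (if Q i = 0 then u else -u⁻¹) ^ Q i = (-u⁻¹) ^ ∑ i, Q i := by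
        rw [← Finset.prod_pow_eq_pow_sum]
        refine Finset.prod_congr rfl fun i _ => ?_
        by_cases h : Q i = 0 <;> simp [h]
      rw [e₁, e₂]
      rw [pow_add, eq_div_iff h₁] at huN
      have hq : u ^ (∑ i, Q i) ≠ 0 := pow_ne_zero _ hu0
      rw [neg_pow, inv_pow]
      field_simp
      linear_combination huN
  constructor
  · by_contra! h
    obtain ⟨u, hu, hu'⟩ := exists_pow_eq_of_im_pos ha (Or.inl h)
    exact key u hu hu'
  · intro h
    by_contra h'
    obtain ⟨u, hu, hu'⟩ := exists_pow_eq_of_im_pos ha (Or.inr ⟨h, h'⟩)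
    exact key u hu hu'

/-- If one monomial of a binomial involves a power `w ^ m` of an off-diagonal entry `w` at the
position `(k, l)`, then stability forces the binomial to be `c₁ z_k z_l + c₂ w ^ 2`. -/
lemma exponents_of_stable_offDiag {ι : Type*} [Fintype ι] {P Q : ι → ℕ}
    (hPQ : ∀ i, P i = 0 ∨ Q i = 0) {c₁ c₂ : ℂ} (h₁ : c₁ ≠ 0) (h₂ : c₂ ≠ 0)
    {k l : ι} (hkl : k ≠ l) {m : ℕ} (hm : m ≠ 0)
    (H : ∀ (z : ι → ℂ) (w : ℂ), (∀ i, 0 < (z i).im) → w.im ^ 2 < (z k).im * (z l).im →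
      c₁ * ∏ i, z i ^ P i + c₂ * ((∏ i, z i ^ Q i) * w ^ m) ≠ 0) :
    m = 2 ∧ P k = 1 ∧ P l = 1 ∧ (∀ i, i ≠ k → i ≠ l → P i = 0) ∧ (∀ i, Q i = 0) ∧
      ∃ r : ℝ, c₁ / c₂ = r := by
  classical
  have key : ∀ k l : ι, k ≠ l → (∀ (z : ι → ℂ) (w : ℂ), (∀ i, 0 < (z i).im) →
      w.im ^ 2 < (z k).im * (z l).im →
      c₁ * ∏ i, z i ^ P i + c₂ * ((∏ i, z i ^ Q i) * w ^ m) ≠ 0) → P k + Q k ≠ 0 := by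
    intro k l hkl H h0
    -- Solve for `w` with all diagonal entries `I`, then enlarge the `k`-th one, on which neither
    -- product depends.
    obtain ⟨w, hw⟩ := IsAlgClosed.exists_pow_nat_eq
      (-(c₁ * ∏ i, Complex.I ^ P i) / (c₂ * ∏ i, Complex.I ^ Q i)) (Nat.pos_of_ne_zero hm)
    have hprod : ∀ R : ι → ℕ, R k = 0 → ∏ i, (if i = k then
        Complex.I * ((w.im ^ 2 + 1 : ℝ) : ℂ) else Complex.I) ^ R i = ∏ i, Complex.I ^ R i := by
      intro R hR
      refine Finset.prod_congr rfl fun i _ => ?_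
      split_ifs with h
      · simp [h, hR]
      · rfl
    refine H (fun i => if i = k then Complex.I * ((w.im ^ 2 + 1 : ℝ) : ℂ) else Complex.I) w ?_ ?_ ?_
    · intro i
      split_ifs
      · rw [Complex.im_mul_ofReal, Complex.I_im]; positivity
      · simp
    · simp only [if_true, if_neg hkl.symm, Complex.im_mul_ofReal, Complex.I_im]
      linarith
    · rw [hprod P (by omega), hprod Q (by omega), hw]
      have : ∏ i, Complex.I ^ Q i ≠ 0 :=
        Finset.prod_ne_zero_iff.2 fun i _ => pow_ne_zero _ Complex.I_ne_zero
      field_simp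
      ring
  have hk := key k l hkl H
  have hl := key l k hkl.symm fun z w hz hw => H z w hz (by rwa [mul_comm])
  -- At the real value `w = 1` the constraint holds for every `z` in the upper half-plane.
  obtain ⟨hle, hreal⟩ := sum_add_sum_le_two_of_stable hPQ h₁ h₂ fun z hz => by
    simpa using H z 1 hz (by simpa using mul_pos (hz k) (hz l))
  have hsplit : ∀ R : ι → ℕ, ∑ i, R i = R k + (R l + ∑ i ∈ (Finset.univ.erase k).erase l, R i) := by
    intro R
    rw [Finset.add_sum_erase _ _ (by simp [hkl.symm]), Finset.add_sum_erase _ _ (by simp)]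
  have hP := hsplit P
  have hQ := hsplit Q
  have hP0 : ∑ i ∈ (Finset.univ.erase k).erase l, P i = 0 := by omega
  have hQ0 : ∑ i ∈ (Finset.univ.erase k).erase l, Q i = 0 := by omega
  have hz : ∀ x : ℝ, 0 < x → ∀ w : ℂ, w.im ^ 2 < x ^ 2 →
      c₁ * (Complex.I * x) ^ (∑ i, P i) + c₂ * ((Complex.I * x) ^ (∑ i, Q i) * w ^ m) ≠ 0 := by
    intro x hx w hw
    have := H (fun _ => Complex.I * x) w (fun i => by simpa using hx) (by simpa [sq] using hw)
    simpa [Finset.prod_pow_eq_pow_sum] using this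
  have hPk := hPQ k
  have hPl := hPQ l
  have hI : Complex.I ^ 2 = -1 := Complex.I_sq
  obtain ⟨w₀, hw₀⟩ := IsAlgClosed.exists_pow_nat_eq (c₁ / c₂) (Nat.pos_of_ne_zero hm)
  have hx : |w₀.im| < 1 + |w₀.im| := by linarith
  have hx0 := abs_nonneg w₀.im
  set x : ℝ := 1 + |w₀.im| with hxdef
  have hx1 : 1 ≤ x := by linarith
  have hx2 : w₀.im ^ 2 < x ^ 2 := by rw [← sq_abs]; gcongr
  have hxC : (x : ℂ) ≠ 0 := by
    have : x ≠ 0 := by positivity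
    exact_mod_cast this
  have hcase : ∑ i, P i = 2 ∧ ∑ i, Q i = 0 ∨ ∑ i, P i = 1 ∧ ∑ i, Q i = 1 ∨
    ∑ i, P i = 0 ∧ ∑ i, Q i = 2 := by omega
  rcases hcase with ⟨hp, hq⟩ | ⟨hp, hq⟩ | ⟨hp, hq⟩
  · rw [hp, hq] at hz
    have hm2 : m = 2 := by
      -- A zero needs `w ^ m = t² c₁/c₂` at height `t`, so `w` scales as `t ^ (2/m)`, while `|Im w|
      -- < t` is required. For `m = 1` a small `t` gives a zero, for `m ≥ 3` a large one.
      rcases lt_trichotomy m 2 with h | h | h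
      · obtain rfl : m = 1 := by omega
        rw [pow_one] at hw₀
        refine absurd ?_ (hz x⁻¹ (by positivity) (w₀ * ((x⁻¹ ^ 2 : ℝ) : ℂ)) ?_)
        · rw [hw₀]; push_cast; field_simp; linear_combination c₁ * hI
        · rw [Complex.im_mul_ofReal, mul_pow]
          calc w₀.im ^ 2 * (x⁻¹ ^ 2) ^ 2 < x ^ 2 * (x⁻¹ ^ 2) ^ 2 := by gcongr
            _ = x⁻¹ ^ 2 := by field_simp
      · exact h
      · refine absurd ?_ (hz (x ^ m) (by positivity) (w₀ * ((x ^ 2 : ℝ) : ℂ)) ?_)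
        · rw [mul_pow w₀, hw₀]; push_cast; field_simp; linear_combination c₁ * x ^ (2 * m) * hI
        · rw [Complex.im_mul_ofReal, mul_pow]
          calc w₀.im ^ 2 * (x ^ 2) ^ 2 < x ^ 2 * (x ^ 2) ^ 2 := by gcongr
            _ = (x ^ 3) ^ 2 := by ring
            _ ≤ (x ^ m) ^ 2 := pow_le_pow_left₀ (by positivity)
              (pow_le_pow_right₀ hx1 h) 2
    refine ⟨hm2, by omega, by omega, ?_, ?_, ?_⟩
    · intro i hik hil
      exact Finset.sum_eq_zero_iff.1 hP0 i (by simp [hik, hil])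
    · intro i
      exact Finset.sum_eq_zero_iff.1 hq i (by simp)
    -- The sign condition at `w = 1` even makes the ratio negative; only its reality is kept.
    · obtain ⟨r, -, hr⟩ := hreal (by omega)
      refine ⟨-r⁻¹, ?_⟩
      push_cast
      rw [← hr, hq]
      field_simp
  · rw [hp, hq] at hz
    -- The factors `I * x` cancel, so `w` does not depend on `x`, which can be taken large.
    obtain ⟨w, hw⟩ := IsAlgClosed.exists_pow_nat_eq (-c₁ / c₂) (Nat.pos_of_ne_zero hm)
    refine absurd ?_ (hz (1 + |w.im|) (by positivity) w ?_)
    · rw [hw]; field_simp; ring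
    · rw [← sq_abs]; gcongr; linarith
  · rw [hp, hq] at hz
    refine absurd ?_ (hz (x ^ m) (by positivity) (w₀ * ((x⁻¹ ^ 2 : ℝ) : ℂ)) ?_)
    · rw [mul_pow w₀, hw₀]; push_cast; rw [inv_pow, inv_pow]; field_simp
      linear_combination c₁ * x ^ (2 * m) * hI
    · rw [Complex.im_mul_ofReal, mul_pow]
      calc w₀.im ^ 2 * (x⁻¹ ^ 2) ^ 2 < x ^ 2 * (x⁻¹ ^ 2) ^ 2 := by gcongr
        _ = x⁻¹ ^ 2 := by field_simp
        _ ≤ 1 := pow_le_one₀ (by positivity) (inv_le_one_of_one_le₀ hx1)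
        _ ≤ (x ^ m) ^ 2 := one_le_pow₀ (one_le_pow₀ hx1)

/-! ### Test matrices and evaluation of monomials -/

lemma posDef_diagonal_add_offDiag {n : ℕ} {y : Fin n → ℝ} (hy : ∀ i, 0 < y i) {k l : Fin n}
    (hkl : k ≠ l) {s : ℝ} (hs : s ^ 2 < y k * y l) :
    (Matrix.diagonal y + Matrix.single k l s + Matrix.single l k s).PosDef := by
  refine Matrix.PosDef.of_dotProduct_mulVec_pos ?_ fun x hx => ?_
  · ext i j
    simp only [Matrix.conjTranspose_apply, Matrix.add_apply, star_trivial, Matrix.single_apply,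
      Matrix.diagonal_apply]
    grind
  · have hform : star x ⬝ᵥ ((Matrix.diagonal y + Matrix.single k l s + Matrix.single l k s).mulVec x)
        = ∑ i, y i * x i ^ 2 + 2 * s * x k * x l := by
      rw [Matrix.add_mulVec, Matrix.add_mulVec, dotProduct_add, dotProduct_add]
      simp only [star_trivial, Matrix.single_mulVec, dotProduct, Matrix.mulVec_diagonal,
        Function.update_apply, mul_ite, Pi.zero_apply, mul_zero, Finset.sum_ite_eq',
        Finset.mem_univ, if_true]
      rw [add_assoc]
      congr 1
      · exact Finset.sum_congr rfl fun i _ => by ring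
      · ring
    rw [hform, ← Finset.add_sum_erase _ _ (Finset.mem_univ k),
      ← Finset.add_sum_erase _ _ (show l ∈ Finset.univ.erase k by simp [hkl.symm])]
    have hnonneg : ∀ i ∈ (Finset.univ.erase k).erase l, 0 ≤ y i * x i ^ 2 := fun i _ =>
      mul_nonneg (hy i).le (sq_nonneg _)
    have hrest := Finset.sum_nonneg hnonneg
    have hk := hy k
    have hl := hy l
    by_cases hxk : x k = 0
    · by_cases hxl : x l = 0
      · obtain ⟨i, hi⟩ := Function.ne_iff.1 hx
        have hi' : x i ≠ 0 := hi
        have : 0 < ∑ i ∈ (Finset.univ.erase k).erase l, y i * x i ^ 2 := by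
          refine Finset.sum_pos' hnonneg ⟨i, ?_, mul_pos (hy i) (by positivity)⟩
          simp only [Finset.mem_erase, Finset.mem_univ, and_true]
          exact ⟨fun h => hi' (h ▸ hxl), fun h => hi' (h ▸ hxk)⟩
        simpa [hxk, hxl] using this
      · have : 0 < y l * x l ^ 2 := by positivity
        simp only [hxk]
        linarith
    -- Completing the square: `y l` times the form in `x k`, `x l` is `(y l * x l + s * x k)²` plus
    -- this term.
    · have h1 : 0 < (y k * y l - s ^ 2) * x k ^ 2 := mul_pos (by linarith) (by positivity)
      have h2 : 0 < y l * (y k * x k ^ 2 + 2 * s * x k * x l + y l * x l ^ 2) := by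
        nlinarith [sq_nonneg (y l * x l + s * x k)]
      have h3 := (mul_pos_iff_of_pos_left hl).1 h2
      linarith

/-- The matrix with diagonal `z` and off-diagonal entries `W`. -/
def matrixOfDiagOffDiag {n : ℕ} (z : Fin n → ℂ) (W : Matrix (Fin n) (Fin n) ℂ) :
    Matrix (Fin n) (Fin n) ℂ :=
  Matrix.of fun i j => if i = j then z i else W i j

lemma diagVar_isDiag {n : ℕ} (i : Fin n) : (diagVar i).IsDiag := rfl

lemma diagVar_injective {n : ℕ} : Function.Injective (diagVar : Fin n → SymVar n) :=
  fun _ _ h => congrArg (fun v : SymVar n => v.1.1) h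

lemma SymVar.IsDiag.exists_eq {n : ℕ} {v : SymVar n} (h : v.IsDiag) : ∃ i, v = diagVar i :=
  ⟨v.1.1, Subtype.ext (Prod.ext rfl h.symm)⟩

open scoped Classical in
lemma SymVar.prod_eq {n : ℕ} (F : SymVar n → ℂ) :
    ∏ v, F v = (∏ i, F (diagVar i)) * ∏ v with ¬ v.IsDiag, F v := by
  rw [← Finset.prod_filter_mul_prod_filter_not Finset.univ SymVar.IsDiag]
  congr 1
  rw [← Finset.prod_image (s := Finset.univ) (g := diagVar) (f := F)
    (fun _ _ _ _ h => diagVar_injective h)]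
  refine Finset.prod_congr ?_ fun _ _ => rfl
  ext v
  simp only [Finset.mem_filter, Finset.mem_univ, true_and, Finset.mem_image]
  exact ⟨fun h => h.exists_eq.imp fun i hi => hi.symm, by rintro ⟨i, rfl⟩; exact diagVar_isDiag i⟩

open scoped Classical in
lemma evalMatrix_monomial {n : ℕ} (α : SymVar n →₀ ℕ) (c : ℂ) (z : Fin n → ℂ)
    (W : Matrix (Fin n) (Fin n) ℂ) :
    evalMatrix (monomial α c) (matrixOfDiagOffDiag z W) = c * ((∏ i, z i ^ α (diagVar i)) *
      ∏ v : SymVar n with ¬ v.IsDiag, W v.1.1 v.1.2 ^ α v) := by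
  rw [evalMatrix, eval_monomial, Finsupp.prod_fintype _ _ (by simp), SymVar.prod_eq]
  congr 2
  · simp [matrixOfDiagOffDiag, diagVar]
  · refine Finset.prod_congr rfl fun v hv => ?_
    have : ¬ v.1.1 = v.1.2 := (Finset.mem_filter.1 hv).2
    simp [matrixOfDiagOffDiag, this]

lemma IsDiagExponent.apply_eq_zero {n : ℕ} {α : SymVar n →₀ ℕ} (h : IsDiagExponent α)
    {v : SymVar n} (hv : ¬ v.IsDiag) : α v = 0 := by
  by_contra h0
  exact hv (h v (Finsupp.mem_support_iff.2 h0))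

lemma evalMatrix_monomial_of_isDiagExponent {n : ℕ} {α : SymVar n →₀ ℕ} (hα : IsDiagExponent α)
    (c : ℂ) (z : Fin n → ℂ) (W : Matrix (Fin n) (Fin n) ℂ) :
    evalMatrix (monomial α c) (matrixOfDiagOffDiag z W) = c * ∏ i, z i ^ α (diagVar i) := by
  classical
  have h1 : ∏ v : SymVar n with ¬ v.IsDiag, W v.1.1 v.1.2 ^ α v = 1 := by
    refine Finset.prod_eq_one fun v hv => ?_
    rw [hα.apply_eq_zero (Finset.mem_filter.1 hv).2, pow_zero]
  rw [evalMatrix_monomial, h1, mul_one]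

lemma evalMatrix_monomial_eq_zero {n : ℕ} {α : SymVar n →₀ ℕ} (hα : ¬ IsDiagExponent α)
    (c : ℂ) (z : Fin n → ℂ) :
    evalMatrix (monomial α c) (matrixOfDiagOffDiag z 0) = 0 := by
  classical
  simp only [IsDiagExponent, not_forall] at hα
  obtain ⟨v, hv, hv'⟩ := hα
  rw [evalMatrix_monomial, Finset.prod_eq_zero (i := v), mul_zero, mul_zero]
  · simp [hv']
  · simp [Finsupp.mem_support_iff.1 hv]

/-- Real off-diagonal entries leave the imaginary part diagonal, so positivity only constrains `z`.
-/
lemma PsdStable.evalMatrix_ne_zero {n : ℕ} {f : SymPoly n} (hf : PsdStable f) {z : Fin n → ℂ}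
    (hz : ∀ i, 0 < (z i).im) {W : Matrix (Fin n) (Fin n) ℂ} (hW : W.IsSymm)
    (hWim : ∀ i j, (W i j).im = 0) : evalMatrix f (matrixOfDiagOffDiag z W) ≠ 0 := by
  refine hf _ ?_ ?_
  · ext i j
    have := hW.apply i j
    simp only [matrixOfDiagOffDiag, Matrix.transpose_apply, Matrix.of_apply]
    grind
  · convert! Matrix.PosDef.diagonal hz
    ext i j
    simp only [matrixOfDiagOffDiag, Matrix.map_apply, Matrix.of_apply, Matrix.diagonal_apply]
    split_ifs
    · rfl
    · exact hWim i j

/-- The symmetric matrix with entry `w` at the positions `(k, l)` and `(l, k)` and `1` elsewhere. -/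
def symmUpdateOne {n : ℕ} (k l : Fin n) (w : ℂ) : Matrix (Fin n) (Fin n) ℂ :=
  Matrix.of fun i j => if (i = k ∧ j = l) ∨ (i = l ∧ j = k) then w else 1

lemma PsdStable.evalMatrix_symmUpdateOne_ne_zero {n : ℕ} {f : SymPoly n} (hf : PsdStable f)
    {z : Fin n → ℂ} (hz : ∀ i, 0 < (z i).im) {k l : Fin n} (hkl : k ≠ l) {w : ℂ}
    (hw : w.im ^ 2 < (z k).im * (z l).im) :
    evalMatrix f (matrixOfDiagOffDiag z (symmUpdateOne k l w)) ≠ 0 := by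
  refine hf _ ?_ ?_
  · ext i j
    simp only [matrixOfDiagOffDiag, symmUpdateOne, Matrix.transpose_apply, Matrix.of_apply]
    grind
  · convert! posDef_diagonal_add_offDiag hz hkl hw
    ext i j
    simp only [matrixOfDiagOffDiag, symmUpdateOne, Matrix.map_apply, Matrix.of_apply,
      Matrix.diagonal_apply, Matrix.add_apply, Matrix.single_apply]
    by_cases hij : i = j
    · subst hij
      have h1 : ¬ (k = i ∧ l = i) := fun h => hkl (h.1.trans h.2.symm)
      have h2 : ¬ (l = i ∧ k = i) := fun h => hkl (h.2.trans h.1.symm)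
      simp [h1, h2]
    · by_cases h1 : i = k ∧ j = l
      · obtain ⟨rfl, rfl⟩ := h1
        simp [hij, Ne.symm hij]
      · by_cases h2 : i = l ∧ j = k
        · obtain ⟨rfl, rfl⟩ := h2
          simp [hij, Ne.symm hij]
        · have h1' : ¬ (k = i ∧ l = j) := by tauto
          have h2' : ¬ (l = i ∧ k = j) := by tauto
          simp [hij, h1, h2]
          grind

/-- The entries `1` remove the other off-diagonal variables without killing the monomial. -/
lemma evalMatrix_monomial_symmUpdateOne {n : ℕ} (α : SymVar n →₀ ℕ) (c : ℂ) (z : Fin n → ℂ)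
    (v : SymVar n) (hv : ¬ v.IsDiag) (w : ℂ) :
    evalMatrix (monomial α c) (matrixOfDiagOffDiag z (symmUpdateOne v.1.1 v.1.2 w)) =
      c * ((∏ i, z i ^ α (diagVar i)) * w ^ α v) := by
  classical
  rw [evalMatrix_monomial, Finset.prod_eq_single v]
  · simp [symmUpdateOne]
  · intro u hu huv
    have hu' : ¬ ((u.1.1 = v.1.1 ∧ u.1.2 = v.1.2) ∨ (u.1.1 = v.1.2 ∧ u.1.2 = v.1.1)) := by
      rintro (⟨h1, h2⟩ | ⟨h1, h2⟩)
      · exact huv (Subtype.ext (Prod.ext h1 h2))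
      · refine hv (le_antisymm v.2 ?_)
        rw [← h1, ← h2]
        exact u.2
    simp only [symmUpdateOne, Matrix.of_apply, if_neg hu', one_pow]
  · simp [hv]

/-! ### Stable factors and diagonal exponents -/

lemma evalMatrix_add {n : ℕ} (f g : SymPoly n) (M : Matrix (Fin n) (Fin n) ℂ) :
    evalMatrix (f + g) M = evalMatrix f M + evalMatrix g M := map_add _ _ _

lemma evalMatrix_mul {n : ℕ} (f g : SymPoly n) (M : Matrix (Fin n) (Fin n) ℂ) :
    evalMatrix (f * g) M = evalMatrix f M * evalMatrix g M := map_mul _ _ _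

lemma PsdStable.of_mul_right {n : ℕ} {f g : SymPoly n} (h : PsdStable (f * g)) : PsdStable g :=
  fun M hM hM' h0 => h M hM hM' (by rw [evalMatrix_mul, h0, mul_zero])

lemma PsdStable.of_mul_left {n : ℕ} {f g : SymPoly n} (h : PsdStable (f * g)) : PsdStable f :=
  fun M hM hM' h0 => h M hM hM' (by rw [evalMatrix_mul, h0, zero_mul])

lemma PsdStable.isDiagExponent {n : ℕ} {γ : SymVar n →₀ ℕ} {c : ℂ}
    (h : PsdStable (monomial γ c)) : IsDiagExponent γ := by
  by_contra hγ
  exact h.evalMatrix_ne_zero (z := fun _ => Complex.I) (W := 0) (by simp)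
    (Matrix.isSymm_zero) (by simp) (evalMatrix_monomial_eq_zero hγ c _)

lemma PsdStable.isDiagExponent_or {n : ℕ} {α β : SymVar n →₀ ℕ} {c₁ c₂ : ℂ}
    (h : PsdStable (monomial α c₁ + monomial β c₂)) : IsDiagExponent α ∨ IsDiagExponent β := by
  by_contra! hαβ
  refine h.evalMatrix_ne_zero (z := fun _ => Complex.I) (W := 0) (by simp)
    (Matrix.isSymm_zero) (by simp) ?_
  rw [evalMatrix_add, evalMatrix_monomial_eq_zero hαβ.1, evalMatrix_monomial_eq_zero hαβ.2,
    add_zero]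

lemma IsDiagExponent.exists_single_add {n d : ℕ} {α : SymVar n →₀ ℕ} (hα : IsDiagExponent α)
    (hd : α.degree = d + 1) : ∃ i, ∃ α' : SymVar n →₀ ℕ, IsDiagExponent α' ∧ α'.degree = d ∧
      α = Finsupp.single (diagVar i) 1 + α' := by
  have h0 : α ≠ 0 := by rintro rfl; simp at hd
  obtain ⟨v, hv⟩ := Finsupp.support_nonempty_iff.2 h0
  obtain ⟨i, rfl⟩ := (hα v hv).exists_eq
  have hle : Finsupp.single (diagVar i) 1 ≤ α := by
    rw [Finsupp.single_le_iff]
    exact Nat.one_le_iff_ne_zero.2 (Finsupp.mem_support_iff.1 hv)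
  have hsum := add_tsub_cancel_of_le hle
  refine ⟨i, α - Finsupp.single (diagVar i) 1, fun v hv => hα v ?_, ?_, hsum.symm⟩
  · exact Finsupp.support_tsub hv
  · have := congrArg Finsupp.degree hsum
    rw [map_add, Finsupp.degree_single] at this
    omega

lemma IsDiagExponent.exists_eq_single {n : ℕ} {α : SymVar n →₀ ℕ} (hα : IsDiagExponent α)
    (hd : α.degree = 1) : ∃ i, α = Finsupp.single (diagVar i) 1 := by
  obtain ⟨i, α', -, h0, rfl⟩ := hα.exists_single_add hd
  rw [Finsupp.degree_eq_zero_iff] at h0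
  exact ⟨i, by rw [h0, add_zero]⟩

lemma IsDiagExponent.exists_eq_single_add_single {n : ℕ} {α : SymVar n →₀ ℕ}
    (hα : IsDiagExponent α) (hd : α.degree = 2) :
    ∃ i j, α = Finsupp.single (diagVar i) 1 + Finsupp.single (diagVar j) 1 := by
  obtain ⟨i, α', hα', h1, rfl⟩ := hα.exists_single_add hd
  obtain ⟨j, rfl⟩ := hα'.exists_eq_single h1
  exact ⟨i, j, rfl⟩

lemma IsDiagExponent.degree_eq {n : ℕ} {α : SymVar n →₀ ℕ} (hα : IsDiagExponent α) :
    α.degree = ∑ i, α (diagVar i) := by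
  classical
  rw [Finsupp.degree_eq_sum, ← Finset.sum_image (s := Finset.univ) (g := diagVar) (f := fun v => α v)
    (fun _ _ _ _ h => diagVar_injective h)]
  refine (Finset.sum_subset (Finset.subset_univ _) fun v _ hv => hα.apply_eq_zero fun h => hv ?_).symm
  obtain ⟨i, rfl⟩ := h.exists_eq
  simp

lemma expDist_eq_of_disjoint {n : ℕ} {α β : SymVar n →₀ ℕ} (h : ∀ v, α v = 0 ∨ β v = 0) :
    expDist α β = α.degree + β.degree := by
  rw [expDist, Finsupp.degree_eq_sum, Finsupp.degree_eq_sum]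
  push_cast
  rw [← Finset.sum_add_distrib]
  refine Finset.sum_congr rfl fun v _ => ?_
  rcases h v with h | h <;> simp [h]

/-! ### Classification of coprime stable binomials -/

/-- Degree bound and sign conditions for stable binomials in the diagonal variables. -/
lemma stableBinomialConditions_of_psdStable {n : ℕ} {α β : SymVar n →₀ ℕ} {c₁ c₂ : ℂ}
    (h₁ : c₁ ≠ 0) (h₂ : c₂ ≠ 0) (hne : α ≠ β) (hd : ∀ v, α v = 0 ∨ β v = 0)
    (hα : IsDiagExponent α) (hβ : IsDiagExponent β)
    (h : PsdStable (monomial α c₁ + monomial β c₂)) :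
    expDist α β ≤ 2 ∧ StableBinomialConditions α β c₁ c₂ := by
  obtain ⟨hle, hsign⟩ := sum_add_sum_le_two_of_stable (P := fun i => α (diagVar i))
    (Q := fun i => β (diagVar i)) (fun i => hd _) h₁ h₂ fun z hz => by
      have := h.evalMatrix_ne_zero hz (W := 0) Matrix.isSymm_zero (by simp)
      rwa [evalMatrix_add, evalMatrix_monomial_of_isDiagExponent hα,
        evalMatrix_monomial_of_isDiagExponent hβ] at this
  rw [← hα.degree_eq, ← hβ.degree_eq] at hle hsign
  refine ⟨by rw [expDist_eq_of_disjoint hd]; exact_mod_cast hle, ?_⟩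
  have hpos : α.degree + β.degree ≠ 0 := by
    intro h0
    have ha := (Finsupp.degree_eq_zero_iff α).1 (by omega)
    have hb := (Finsupp.degree_eq_zero_iff β).1 (by omega)
    exact hne (ha.trans hb.symm)
  have hcase : α.degree = 1 ∧ β.degree = 0 ∨ α.degree = 0 ∧ β.degree = 1 ∨
      α.degree = 1 ∧ β.degree = 1 ∨ α.degree = 2 ∧ β.degree = 0 ∨
      α.degree = 0 ∧ β.degree = 2 := by omega
  rcases hcase with ⟨ha, hb⟩ | ⟨ha, hb⟩ | ⟨ha, hb⟩ | ⟨ha, hb⟩ | ⟨ha, hb⟩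
  · obtain ⟨i, rfl⟩ := hα.exists_eq_single ha
    rw [Finsupp.degree_eq_zero_iff] at hb
    exact Or.inl ⟨i, by rw [hb, Set.pair_comm]⟩
  · obtain ⟨i, rfl⟩ := hβ.exists_eq_single hb
    rw [Finsupp.degree_eq_zero_iff] at ha
    exact Or.inl ⟨i, by rw [ha]⟩
  · obtain ⟨r, hr, hr'⟩ := hsign (by omega)
    obtain ⟨i, rfl⟩ := hα.exists_eq_single ha
    obtain ⟨j, rfl⟩ := hβ.exists_eq_single hb
    refine Or.inr (Or.inl ⟨i, j, fun hij => hne (by rw [hij]), rfl, r⁻¹, by positivity, ?_⟩)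
    push_cast
    rw [← hr', hb]
    field_simp
  -- In both remaining cases `β.degree` is even, so the sign condition reads `-c₂/c₁ > 0`.
  all_goals
    obtain ⟨r, hr, hr'⟩ := hsign (by omega)
    have hratio : ∃ r : ℝ, r < 0 ∧ c₁ / c₂ = (r : ℂ) := by
      refine ⟨-r⁻¹, by simpa using hr, ?_⟩
      push_cast
      rw [← hr', hb]
      field_simp
  · obtain ⟨i, j, rfl⟩ := hα.exists_eq_single_add_single ha
    rw [Finsupp.degree_eq_zero_iff] at hb
    exact Or.inr (Or.inr ⟨i, j, by rw [hb, Set.pair_comm], hratio⟩)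
  · obtain ⟨i, j, rfl⟩ := hβ.exists_eq_single_add_single hb
    rw [Finsupp.degree_eq_zero_iff] at ha
    exact Or.inr (Or.inr ⟨i, j, by rw [ha], hratio⟩)

/-- A psd-stable binomial without common factor that contains an off-diagonal variable in the
second monomial is of the form `c₁ z_ii z_jj + c₂ z_ij²`. -/
lemma exponents_of_psdStable {n : ℕ} {α β : SymVar n →₀ ℕ} {c₁ c₂ : ℂ}
    (h₁ : c₁ ≠ 0) (h₂ : c₂ ≠ 0) (hd : ∀ v, α v = 0 ∨ β v = 0)
    (hα : IsDiagExponent α) (hβ : ¬ IsDiagExponent β)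
    (h : PsdStable (monomial α c₁ + monomial β c₂)) :
    ∃ (i j : Fin n) (hij : i < j),
      α = Finsupp.single (diagVar i) 1 + Finsupp.single (diagVar j) 1 ∧
      β = Finsupp.single (offDiagVar i j hij) 2 ∧ ∃ r : ℝ, c₁ / c₂ = r := by
  have key : ∀ v : SymVar n, ¬ v.IsDiag → β v ≠ 0 → β v = 2 ∧ α (diagVar v.1.1) = 1 ∧
      α (diagVar v.1.2) = 1 ∧ (∀ i, i ≠ v.1.1 → i ≠ v.1.2 → α (diagVar i) = 0) ∧
      (∀ i, β (diagVar i) = 0) ∧ ∃ r : ℝ, c₁ / c₂ = r := by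
    intro v hv hβv
    refine exponents_of_stable_offDiag (P := fun i => α (diagVar i))
      (Q := fun i => β (diagVar i)) (fun i => hd _) h₁ h₂ hv hβv fun z w hz hw => ?_
    have := h.evalMatrix_symmUpdateOne_ne_zero hz hv hw
    rwa [evalMatrix_add, evalMatrix_monomial_of_isDiagExponent hα,
      evalMatrix_monomial_symmUpdateOne _ _ _ _ hv] at this
  simp only [IsDiagExponent, not_forall] at hβ
  obtain ⟨v, hvs, hv⟩ := hβ
  obtain ⟨hv2, hk, hl, hαk, hβ0, hr⟩ := key v hv (Finsupp.mem_support_iff.1 hvs)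
  have hlt : v.1.1 < v.1.2 := lt_of_le_of_ne v.2 hv
  refine ⟨v.1.1, v.1.2, hlt, ?_, ?_, hr⟩
  · ext u
    by_cases hu : u.IsDiag
    · obtain ⟨i, rfl⟩ := hu.exists_eq
      simp only [Finsupp.add_apply, Finsupp.single_apply, diagVar_injective.eq_iff]
      by_cases hi : i = v.1.1
      · rw [hi, hk, if_pos rfl, if_neg hlt.ne', add_zero]
      · by_cases hi' : i = v.1.2
        · rw [hi', hl, if_pos rfl, if_neg hlt.ne]
        · rw [hαk i hi hi', if_neg (Ne.symm hi), if_neg (Ne.symm hi'), add_zero]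
    · rw [hα.apply_eq_zero hu]
      have hne : ∀ i, diagVar i ≠ u := fun i hi => hu (hi ▸ diagVar_isDiag i)
      simp [hne]
  · ext u
    have hv' : offDiagVar v.1.1 v.1.2 hlt = v := rfl
    rw [hv', Finsupp.single_apply]
    split_ifs with huv
    · rw [← huv, hv2]
    · by_contra hu0
      by_cases hu : u.IsDiag
      · obtain ⟨i, rfl⟩ := hu.exists_eq
        exact hu0 (hβ0 i)
      -- Another off-diagonal variable in `β` would also force its two diagonal variables into `α`,
      -- which has only those of `v`; hence it is `v`.
      · obtain ⟨-, hk', hl', -, -, -⟩ := key u hu hu0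
        have hlt' : u.1.1 < u.1.2 := lt_of_le_of_ne u.2 hu
        have m1 : u.1.1 = v.1.1 ∨ u.1.1 = v.1.2 := by
          by_contra! hc
          have := hαk _ hc.1 hc.2
          omega
        have m2 : u.1.2 = v.1.1 ∨ u.1.2 = v.1.2 := by
          by_contra! hc
          have := hαk _ hc.1 hc.2
          omega
        have : u.1.1 = v.1.1 ∧ u.1.2 = v.1.2 := by grind
        exact huv (Subtype.ext (Prod.ext this.1.symm this.2.symm))

/-! ### Splitting off the gcd and assembling the result -/

lemma IsBinomial.exists_eq {n : ℕ} {f : SymPoly n} (hf : IsBinomial f) :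
    ∃ (γ α β : SymVar n →₀ ℕ) (c₁ c₂ : ℂ), c₁ ≠ 0 ∧ c₂ ≠ 0 ∧ α ≠ β ∧
      (∀ v, α v = 0 ∨ β v = 0) ∧
      f = monomial γ 1 * (monomial α c₁ + monomial β c₂) := by
  obtain ⟨A, B, hAB, hs⟩ := Finset.card_eq_two.1 hf
  have hA : A ∈ f.support := by simp [hs]
  have hB : B ∈ f.support := by simp [hs]
  have eA : A ⊓ B + (A - A ⊓ B) = A := add_tsub_cancel_of_le inf_le_left
  have eB : A ⊓ B + (B - A ⊓ B) = B := add_tsub_cancel_of_le inf_le_right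
  refine ⟨A ⊓ B, A - A ⊓ B, B - A ⊓ B, f.coeff A, f.coeff B, mem_support_iff.1 hA,
    mem_support_iff.1 hB, ?_, ?_, ?_⟩
  · intro h
    rw [h, eB] at eA
    exact hAB eA.symm
  · intro v
    simp only [Finsupp.tsub_apply, Finsupp.inf_apply]
    omega
  · rw [mul_add, monomial_mul, monomial_mul, one_mul, one_mul, eA, eB]
    conv_lhs => rw [f.as_sum, hs, Finset.sum_pair hAB]

lemma vars_monomial_mul_add_subset {n : ℕ} {γ α β : SymVar n →₀ ℕ} {c₁ c₂ : ℂ} {v : SymVar n}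
    (hv : v ∈ (monomial γ 1 * (monomial α c₁ + monomial β c₂)).vars) :
    γ v ≠ 0 ∨ α v ≠ 0 ∨ β v ≠ 0 := by
  classical
  rw [mul_add, monomial_mul, monomial_mul] at hv
  have := vars_add_subset _ _ hv
  rw [Finset.mem_union] at this
  rcases this with h | h
  all_goals
    obtain ⟨d, hd, hvd⟩ := (mem_vars_iff_mem_support _).1 h
    have := Finset.mem_singleton.1 (support_monomial_subset hd)
    subst this
    simp only [Finsupp.mem_support_iff, Finsupp.add_apply] at hvd
    omega

lemma isOffDiagonalForm_and_vars {n : ℕ} {γ : SymVar n →₀ ℕ} (hγ : IsDiagExponent γ) {c₁ c₂ : ℂ}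
    (h₁ : c₁ ≠ 0) (h₂ : c₂ ≠ 0) {i j : Fin n} (hij : i < j) (hr : ∃ r : ℝ, c₁ / c₂ = r)
    {f : SymPoly n} (hf : f = monomial γ 1 *
      (monomial (Finsupp.single (diagVar i) 1 + Finsupp.single (diagVar j) 1) c₁ +
        monomial (Finsupp.single (offDiagVar i j hij) 2) c₂)) :
    IsOffDiagonalForm f ∧ (∀ v ∈ f.vars, ¬ v.IsDiag → v = offDiagVar i j hij) ∧
      f.degreeOf (offDiagVar i j hij) = 2 := by
  classical
  have hoff : ¬ (offDiagVar i j hij).IsDiag := hij.ne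
  have hne : ∀ k, diagVar k ≠ offDiagVar i j hij := fun k hk => hoff (hk ▸ diagVar_isDiag k)
  refine ⟨⟨γ, i, j, hij, c₁, c₂, hγ, h₁, h₂, hr, ?_⟩, ?_, ?_⟩
  · rw [hf, X_pow_eq_monomial, C_mul_monomial, X, X, C_mul_monomial, monomial_mul, mul_one,
      mul_one, mul_one]
  · intro v hv hv'
    rw [hf] at hv
    have hd : ∀ k, diagVar k ≠ v := fun k hk => hv' (hk ▸ diagVar_isDiag k)
    have := vars_monomial_mul_add_subset hv
    simp only [hγ.apply_eq_zero hv', Finsupp.add_apply, Finsupp.single_apply, hd] at this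
    by_contra hvne
    simp [Ne.symm hvne] at this
  · have hγ0 := hγ.apply_eq_zero hoff
    have hAB : γ + (Finsupp.single (diagVar i) 1 + Finsupp.single (diagVar j) 1) ≠
        γ + Finsupp.single (offDiagVar i j hij) 2 := by
      intro h
      have := DFunLike.congr_fun h (offDiagVar i j hij)
      simp [hne] at this
    rw [hf, mul_add, monomial_mul, monomial_mul, one_mul, one_mul]
    generalize hA : γ + (Finsupp.single (diagVar i) 1 + Finsupp.single (diagVar j) 1) = A at hAB ⊢
    generalize hB : γ + Finsupp.single (offDiagVar i j hij) 2 = B at hAB ⊢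
    have hs : (monomial A c₁ + monomial B c₂).support = {A, B} := by
      ext d
      rw [mem_support_iff, coeff_add, coeff_monomial, coeff_monomial, Finset.mem_insert,
        Finset.mem_singleton]
      by_cases h : A = d
      · subst h; simp [hAB.symm, h₁]
      · by_cases h' : B = d
        · subst h'; simp [h, h₂]
        · simp [h, h', Ne.symm h, Ne.symm h']
    rw [degreeOf_eq_sup, hs, Finset.sup_insert, Finset.sup_singleton, ← hA, ← hB]
    simp [hne, hγ0]

theorem mainTheorem5 (n : ℕ) (f : SymPoly n) (hbin : IsBinomial f) (hstable : PsdStable f) :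
    (IsDiagonalForm f ∨ IsOffDiagonalForm f) ∧
    (∀ v ∈ f.vars, ∀ w ∈ f.vars, ¬ v.IsDiag → ¬ w.IsDiag → v = w) ∧
    (∀ v ∈ f.vars, ¬ v.IsDiag → f.degreeOf v = 2) := by
  obtain ⟨γ, α, β, c₁, c₂, h₁, h₂, hne, hd, hf⟩ := hbin.exists_eq
  have hγ : IsDiagExponent γ := (hf ▸ hstable).of_mul_left.isDiagExponent
  have hg : PsdStable (monomial α c₁ + monomial β c₂) := (hf ▸ hstable).of_mul_right
  by_cases hdiag : IsDiagExponent α ∧ IsDiagExponent β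
  · obtain ⟨hα, hβ⟩ := hdiag
    have hvars : ∀ v ∈ f.vars, v.IsDiag := by
      intro v hv
      by_contra hv'
      rw [hf] at hv
      have := vars_monomial_mul_add_subset hv
      simp [hγ.apply_eq_zero hv', hα.apply_eq_zero hv', hβ.apply_eq_zero hv'] at this
    obtain ⟨hdist, hcond⟩ := stableBinomialConditions_of_psdStable h₁ h₂ hne hd hα hβ hg
    refine ⟨Or.inl ⟨hvars, γ, α, β, c₁, c₂, hγ, hα, hβ, h₁, h₂, hf, ?_, hdist, ?_, hcond⟩,
      fun v hv _ _ hv' => absurd (hvars v hv) hv', fun v hv hv' => absurd (hvars v hv) hv'⟩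
    · rw [Finset.disjoint_left]
      intro v hv hv'
      rcases hd v with h | h
      · exact Finsupp.mem_support_iff.1 hv h
      · exact Finsupp.mem_support_iff.1 hv' h
    · by_contra! h
      exact hne (h.1.trans h.2.symm)
  · obtain ⟨i, j, hij, hform, hvar, hdeg⟩ : ∃ (i j : Fin n) (hij : i < j), IsOffDiagonalForm f ∧
        (∀ v ∈ f.vars, ¬ v.IsDiag → v = offDiagVar i j hij) ∧
        f.degreeOf (offDiagVar i j hij) = 2 := by
      rcases hg.isDiagExponent_or with hα | hβ
      · obtain ⟨i, j, hij, rfl, rfl, hr⟩ :=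
          exponents_of_psdStable h₁ h₂ hd hα (fun h => hdiag ⟨hα, h⟩) hg
        exact ⟨i, j, hij, isOffDiagonalForm_and_vars hγ h₁ h₂ hij hr hf⟩
      · rw [add_comm] at hg hf
        obtain ⟨i, j, hij, rfl, rfl, hr⟩ :=
          exponents_of_psdStable h₂ h₁ (fun v => (hd v).symm) hβ (fun h => hdiag ⟨h, hβ⟩) hg
        exact ⟨i, j, hij, isOffDiagonalForm_and_vars hγ h₂ h₁ hij hr hf⟩
    refine ⟨Or.inr hform, fun v hv w hw hv' hw' => (hvar v hv hv').trans (hvar w hw hw').symm,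
      fun v hv hv' => ?_⟩
    rw [hvar v hv hv', hdeg]
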